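/- Let $r \in \{2, 3, 4, \dots\} \cup \{\infty\}$, and let $\mathrm{Diff}_c^r(\mathbb{R})$ denote the group, under composition, of compactly supported, orientation-preserving $C^r$-diffeomorphisms of $\mathbb{R}$ that are isotopic to the identity (through compactly supported $C^r$-diffeomorphisms). For $g \in \mathrm{Diff}_c^r(\mathbb{R})$ let $$C_{\mathrm{Diff}_c^r(\mathbb{R})}(g) = \{h \in \mathrm{Diff}_c^r(\mathbb{R}) : hg = gh\}$$ denote its centralizer. Then for every $g \in \mathrm{Diff}_c^r(\mathbb{R})$, $$C_{\mathrm{Diff}_c^r(\mathbb{R})}(g) = C_{\mathrm{Diff}_c^r(\mathbb{R})}(g^2).$$ -/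

import Mathlib

open Set
open scoped ContDiff

/-- The group `Diff^r(ℝ)` of `C^r`-diffeomorphisms of the line, as a group of permutations of `ℝ`:
both the map and its inverse are of class `C^r`. -/
def DiffLine (r : ℕ∞) : Subgroup (Equiv.Perm ℝ) where
  carrier := {g | ContDiff ℝ r (g : ℝ → ℝ) ∧ ContDiff ℝ r (g.symm : ℝ → ℝ)}
  mul_mem' := fun {_ _} ha hb => ⟨ha.1.comp hb.1, hb.2.comp ha.2⟩
  one_mem' := ⟨contDiff_id, contDiff_id⟩
  inv_mem' := fun {_} ha => ⟨ha.2, ha.1⟩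

/-- The diffeomorphism `g` has compact support, the support being the closure of the set of
points moved by `g`. -/
def IsCompactlySupported (g : Equiv.Perm ℝ) : Prop :=
  IsCompact (closure {x : ℝ | g x ≠ x})

/-- `g` is isotopic to the identity: there is a `C^r` family `φ s`, `0 ≤ s ≤ 1`, of
`C^r`-diffeomorphisms with supports in one compact set, from `φ 0 = id` to `φ 1 = g`.
(The values `φ s` for `s` outside `[0, 1]` are irrelevant.) -/
def IsIsotopicToId (r : ℕ∞) (g : Equiv.Perm ℝ) : Prop :=
  ∃ φ : ℝ → Equiv.Perm ℝ, φ 0 = 1 ∧ φ 1 = g ∧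
    (∀ s ∈ Icc (0 : ℝ) 1, φ s ∈ DiffLine r) ∧
    ContDiffOn ℝ r (fun p : ℝ × ℝ => φ p.1 p.2) (Icc (0 : ℝ) 1 ×ˢ univ) ∧
    ∃ K : Set ℝ, IsCompact K ∧ ∀ s ∈ Icc (0 : ℝ) 1, ∀ x ∉ K, φ s x = x

/-- The straight-line isotopy, needed to see that the group below is closed under products and
inverses. -/
theorem isIsotopicToId_of_strictMono {r : ℕ∞} {g : Equiv.Perm ℝ} (hg : g ∈ DiffLine r)
    (hc : IsCompactlySupported g) (hm : StrictMono g) : IsIsotopicToId r g := by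
  classical
  have hgc : ContDiff ℝ r (g : ℝ → ℝ) := hg.1
  have hL : ∀ s ∈ Icc (0 : ℝ) 1, ∃ φ : Equiv.Perm ℝ, φ ∈ DiffLine r ∧
      ∀ x, φ x = (1 - s) * x + s * g x := by
    intro s hs
    have hsm : StrictMono (fun x : ℝ => (1 - s) * x + s * g x) := by
      intro x y hxy
      have h2 := hm hxy
      have h3 : 0 ≤ 1 - s := by linarith [hs.2]
      change (1 - s) * x + s * g x < (1 - s) * y + s * g y
      rcases hs.1.eq_or_lt with h0 | h0
      · rw [← h0]; linarith
      · nlinarith [mul_le_mul_of_nonneg_left hxy.le h3, mul_lt_mul_of_pos_left h2 h0]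
    have hcd : ContDiff ℝ r (fun x : ℝ => (1 - s) * x + s * g x) :=
      (contDiff_const.mul contDiff_id).add (contDiff_const.mul hgc)
    have hsurj : Function.Surjective (fun x : ℝ => (1 - s) * x + s * g x) := by
      have h3 : 0 ≤ 1 - s := by linarith [hs.2]
      intro y
      refine mem_range_of_exists_le_of_exists_ge hcd.continuous
        ⟨min y (g.symm y), ?_⟩ ⟨max y (g.symm y), ?_⟩
      · have h1 := min_le_left y (g.symm y)
        have h2 := hm.monotone (min_le_right y (g.symm y))
        rw [g.apply_symm_apply] at h2
        nlinarith [mul_le_mul_of_nonneg_left h1 h3, mul_le_mul_of_nonneg_left h2 hs.1]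
      · have h1 := le_max_left y (g.symm y)
        have h2 := hm.monotone (le_max_right y (g.symm y))
        rw [g.apply_symm_apply] at h2
        nlinarith [mul_le_mul_of_nonneg_left h1 h3, mul_le_mul_of_nonneg_left h2 hs.1]
    let e : ℝ ≃o ℝ := StrictMono.orderIsoOfSurjective _ hsm hsurj
    have he : ∀ x, e x = (1 - s) * x + s * g x := fun x => rfl
    refine ⟨e.toEquiv, ⟨hcd, ?_⟩, he⟩
    rcases eq_or_ne r 0 with rfl | hr
    · exact contDiff_zero.2 e.symm.continuous
    have hr1 : (r : WithTop ℕ∞) ≠ 0 := by exact_mod_cast hr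
    have hd : ∀ x, HasDerivAt g (deriv g x) x := fun x =>
      ((hgc.differentiable hr1) x).hasDerivAt
    have hpos : ∀ x, 0 < deriv g x := by
      intro x
      refine lt_of_le_of_ne hm.monotone.deriv_nonneg ?_
      intro h0
      have hi : HasDerivAt (g.symm : ℝ → ℝ) (deriv g.symm (g x)) (g x) :=
        ((hg.2.differentiable hr1) (g x)).hasDerivAt
      have hcomp := hi.comp x (hd x)
      have hid : (g.symm : ℝ → ℝ) ∘ g = id := funext fun y => g.symm_apply_apply y
      rw [hid, ← h0, mul_zero] at hcomp
      exact zero_ne_one (hcomp.unique (hasDerivAt_id x))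
    refine Homeomorph.contDiff_symm_deriv (f := e.toHomeomorph)
      (f' := fun x => (1 - s) + s * deriv g x) ?_ ?_ hcd
    · intro x
      have := hpos x
      have h3 : 0 ≤ 1 - s := by linarith [hs.2]
      rcases hs.1.eq_or_lt with h0 | h0
      · rw [← h0]; norm_num
      · have := mul_pos h0 this
        exact ne_of_gt (by linarith)
    · intro x
      have := ((hasDerivAt_id x).const_mul (1 - s)).add ((hd x).const_mul s)
      rw [mul_one] at this
      exact this
  choose! φ hφ hφL using hL
  have h0 : (0 : ℝ) ∈ Icc (0 : ℝ) 1 := ⟨le_rfl, zero_le_one⟩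
  have h1 : (1 : ℝ) ∈ Icc (0 : ℝ) 1 := ⟨zero_le_one, le_rfl⟩
  refine ⟨φ, ?_, ?_, hφ, ?_, _, hc, ?_⟩
  · ext x
    simp [hφL 0 h0]
  · ext x
    simp [hφL 1 h1]
  · have hF : ContDiff ℝ r (fun p : ℝ × ℝ => (1 - p.1) * p.2 + p.1 * g p.2) :=
      ((contDiff_const.sub contDiff_fst).mul contDiff_snd).add
        (contDiff_fst.mul (hgc.comp contDiff_snd))
    exact hF.contDiffOn.congr fun p hp => hφL p.1 hp.1 p.2
  · intro s hs x hx
    have hgx : g x = x := by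
      by_contra h
      exact hx (subset_closure h)
    rw [hφL s hs, hgx]
    ring

theorem IsCompactlySupported.mul {g h : Equiv.Perm ℝ} (hg : IsCompactlySupported g)
    (hh : IsCompactlySupported h) : IsCompactlySupported (g * h) := by
  refine (IsCompact.union hg hh).of_isClosed_subset isClosed_closure ?_
  rw [← closure_union]
  refine closure_mono fun x hx => ?_
  by_contra hn
  simp only [mem_union, mem_ofPred_eq, not_or, not_not] at hn
  exact hx (by rw [Equiv.Perm.mul_apply, hn.2, hn.1])

theorem IsCompactlySupported.inv {g : Equiv.Perm ℝ} (hg : IsCompactlySupported g) :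
    IsCompactlySupported g⁻¹ := by
  have : {x : ℝ | g⁻¹ x ≠ x} = {x : ℝ | g x ≠ x} := by
    ext x
    exact not_congr (Equiv.Perm.inv_eq_iff_eq.trans eq_comm)
  rw [IsCompactlySupported, this]
  exact hg

theorem isCompactlySupported_one : IsCompactlySupported 1 := by
  simp [IsCompactlySupported]

theorem strictMono_inv {g : Equiv.Perm ℝ} (hg : StrictMono g) :
    StrictMono (g⁻¹ : Equiv.Perm ℝ) := by
  intro x y hxy
  rw [← hg.lt_iff_lt]
  simpa using hxy

/-- The group `Diff_c^r(ℝ)` of compactly supported, orientation-preserving `C^r`-diffeomorphisms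
of `ℝ` isotopic to the identity. A diffeomorphism of the line is orientation-preserving exactly
when it is strictly increasing. -/
def DiffcLine (r : ℕ∞) : Subgroup (Equiv.Perm ℝ) where
  carrier := {g | g ∈ DiffLine r ∧ IsCompactlySupported g ∧ StrictMono g ∧ IsIsotopicToId r g}
  mul_mem' := fun {_ _} ha hb =>
    have hm := mul_mem ha.1 hb.1
    have hc := ha.2.1.mul hb.2.1
    have ho := ha.2.2.1.comp hb.2.2.1
    ⟨hm, hc, ho, isIsotopicToId_of_strictMono hm hc ho⟩
  one_mem' :=
    ⟨one_mem _, isCompactlySupported_one, strictMono_id,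
      isIsotopicToId_of_strictMono (one_mem _) isCompactlySupported_one strictMono_id⟩
  inv_mem' := fun {_} ha =>
    have hm := inv_mem ha.1
    have hc := ha.2.1.inv
    have ho := strictMono_inv ha.2.2.1
    ⟨hm, hc, ho, isIsotopicToId_of_strictMono hm hc ho⟩

/-! If `h` commutes with `g²`, then `hgh⁻¹` and `g` have the same square, so the claim reduces to
uniqueness of square roots (`eq_of_sq_eq`). Let `k² = g²` and let `f = g²` move `x` down. The graphs
of `k` and `g` cross at some `p` in `[g x, x]`, so `w = g⁻¹k` fixes `p`, and it commutes with `f`.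
Kopell's lemma (`eq_self_of_commute_of_fixed`) makes `w` the identity on `[f p, p]`, hence at `x`.
Kopell's lemma rests on bounded distortion of the iterates of a `C²` map: all monotone `C¹` maps
commuting with `f` and fixing `p` share one Lipschitz constant on `[f p, p]`. The powers of `w⁻¹`
are such maps, yet they would expand without bound if `w` moved a point. -/

/-! ### Bounded distortion -/

/-- If `f'` is Lipschitz and bounded away from zero on an interval, the difference quotients of `f`
over pairs of points of a subinterval agree up to a factor that is exponential in its length. -/
theorem exists_distortion_bound {f : ℝ → ℝ} (hf : ContDiff ℝ 2 f) (hpos : ∀ x, 0 < deriv f x)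
    (a b : ℝ) :
    ∃ C : ℝ, 0 ≤ C ∧ ∀ A B, a ≤ A → B ≤ b → ∀ x ∈ Icc A B, ∀ x' ∈ Icc A B, ∀ y ∈ Icc A B,
      ∀ y' ∈ Icc A B,
      |f x - f x'| * |y - y'| ≤ Real.exp (C * (B - A)) * (|f y - f y'| * |x - x'|) := by
  have hd : ContDiff ℝ 1 (deriv f) := (contDiff_succ_iff_deriv (n := 1)).1 hf |>.2.2
  have hdf : Differentiable ℝ f := hf.differentiable (by norm_num)
  obtain ⟨M, hM⟩ := (isCompact_Icc (a := a) (b := b)).exists_bound_of_continuousOn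
    (hd.continuous_deriv le_rfl).continuousOn
  obtain ⟨m, hm, hmle⟩ : ∃ m, 0 < m ∧ ∀ x ∈ Icc a b, m ≤ deriv f x := by
    rcases (Icc a b).eq_empty_or_nonempty with he | hne
    · exact ⟨1, one_pos, by simp [he]⟩
    · obtain ⟨x, -, hx⟩ := isCompact_Icc.exists_isMinOn hne hd.continuous.continuousOn
      exact ⟨deriv f x, hpos x, fun y hy => hx hy⟩
  have hmean : ∀ {A B x y : ℝ}, x ∈ Icc A B → y ∈ Icc A B →
      ∃ ξ ∈ Icc A B, |f x - f y| = deriv f ξ * |x - y| := by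
    intro A B
    have key : ∀ {x y : ℝ}, x ∈ Icc A B → y ∈ Icc A B → x < y →
        ∃ ξ ∈ Icc A B, |f x - f y| = deriv f ξ * |x - y| := by
      intro x y hx hy hxy
      obtain ⟨ξ, hξ, he⟩ := exists_deriv_eq_slope f hxy hdf.continuous.continuousOn
        hdf.differentiableOn
      refine ⟨ξ, ⟨hx.1.trans hξ.1.le, hξ.2.le.trans hy.2⟩, ?_⟩
      have h0 : y - x ≠ 0 := sub_ne_zero.2 hxy.ne'
      rw [eq_div_iff h0] at he
      rw [abs_sub_comm, ← he, abs_mul, abs_of_pos (hpos ξ), abs_sub_comm]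
    intro x y hx hy
    rcases lt_trichotomy x y with h | h | h
    · exact key hx hy h
    · exact ⟨x, hx, by simp [h]⟩
    · obtain ⟨ξ, hξ, he⟩ := key hy hx h
      exact ⟨ξ, hξ, by rw [abs_sub_comm, he, abs_sub_comm]⟩
  -- This bounds `f''/f'`, the derivative of `log f'`.
  refine ⟨|M| / m, by positivity, ?_⟩
  intro A B hA hB x hx x' hx' y hy y' hy'
  obtain ⟨ξ, hξ, e1⟩ := hmean hx hx'
  obtain ⟨η, hη, e2⟩ := hmean hy hy'
  have hsub : Icc A B ⊆ Icc a b := Icc_subset_Icc hA hB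
  have hAB : 0 ≤ B - A := by linarith [hx.1, hx.2]
  have hle : deriv f ξ ≤ Real.exp (|M| / m * (B - A)) * deriv f η := by
    have hlip : ‖deriv f ξ - deriv f η‖ ≤ M * ‖ξ - η‖ :=
      (convex_Icc a b).norm_image_sub_le_of_norm_deriv_le
        (fun z _ => hd.differentiable (by norm_num) z) hM (hsub hη) (hsub hξ)
    have h1 : |ξ - η| ≤ B - A := abs_sub_le_iff.2
      ⟨by linarith [hξ.2, hη.1], by linarith [hη.2, hξ.1]⟩
    have h2 : deriv f ξ - deriv f η ≤ |M| * (B - A) :=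
      calc deriv f ξ - deriv f η ≤ M * |ξ - η| := (le_abs_self _).trans hlip
        _ ≤ |M| * (B - A) := by gcongr; exact le_abs_self M
    have h3 : |M| * (B - A) ≤ |M| / m * (B - A) * deriv f η := by
      have : |M| * (B - A) = |M| / m * (B - A) * m := by field_simp
      rw [this]
      gcongr
      exact hmle η (hsub hη)
    have h4 := mul_le_mul_of_nonneg_right (Real.add_one_le_exp (|M| / m * (B - A))) (hpos η).le
    linarith
  rw [e1, e2]
  calc deriv f ξ * |x - x'| * |y - y'|
      ≤ Real.exp (|M| / m * (B - A)) * deriv f η * |x - x'| * |y - y'| := by gcongr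
    _ = _ := by ring

/-- Bounded distortion of the iterates of `f` on the fundamental domain `[f p, p]`. -/
theorem exists_iterate_distortion_bound {f : ℝ → ℝ} (hf : ContDiff ℝ 2 f)
    (hpos : ∀ x, 0 < deriv f x) {a p : ℝ} (hmono : StrictMono f) (hp : f p ≤ p)
    (ha : ∀ n : ℕ, a ≤ f^[n] p) :
    ∃ E : ℝ, 0 ≤ E ∧ ∀ n : ℕ, ∀ x ∈ Icc (f p) p, ∀ x' ∈ Icc (f p) p, ∀ y ∈ Icc (f p) p,
      ∀ y' ∈ Icc (f p) p,
      |f^[n] x - f^[n] x'| * |y - y'| ≤ E * (|f^[n] y - f^[n] y'| * |x - x'|) := by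
  obtain ⟨C, hC, hdist⟩ := exists_distortion_bound hf hpos a p
  have hanti : Antitone fun n : ℕ => f^[n] p := by
    refine antitone_nat_of_succ_le fun n => ?_
    rw [Function.iterate_succ_apply]
    exact (hmono.iterate n).monotone hp
  have hmem : ∀ (n : ℕ) {x}, x ∈ Icc (f p) p → f^[n] x ∈ Icc (f^[n + 1] p) (f^[n] p) := by
    intro n x hx
    rw [Function.iterate_succ_apply]
    exact ⟨(hmono.iterate n).monotone hx.1, (hmono.iterate n).monotone hx.2⟩
  refine ⟨Real.exp (C * (p - a)), (Real.exp_pos _).le, ?_⟩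
  intro n x hx x' hx' y hy y' hy'
  -- The length `p - f^[n] p` is the sum of the lengths of the first `n` images of `[f p, p]`, so
  -- the one-step exponents telescope.
  have key : ∀ n : ℕ, |f^[n] x - f^[n] x'| * |y - y'| ≤
      Real.exp (C * (p - f^[n] p)) * (|f^[n] y - f^[n] y'| * |x - x'|) := by
    intro n
    induction n with
    | zero => simp [mul_comm]
    | succ n ih =>
      rcases eq_or_ne y y' with rfl | hne
      · simp
      have hpos' : 0 < |f^[n] y - f^[n] y'| :=
        abs_pos.2 (sub_ne_zero.2 ((hmono.iterate n).injective.ne hne))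
      have h1 := hdist _ _ (ha (n + 1)) (hanti (Nat.zero_le n)) _ (hmem n hx) _ (hmem n hx') _
        (hmem n hy) _ (hmem n hy')
      simp only [← Function.iterate_succ_apply' f] at h1
      refine le_of_mul_le_mul_right ?_ hpos'
      calc |f^[n + 1] x - f^[n + 1] x'| * |y - y'| * |f^[n] y - f^[n] y'|
          = (|f^[n + 1] x - f^[n + 1] x'| * |f^[n] y - f^[n] y'|) * |y - y'| := by ring
        _ ≤ (Real.exp (C * (f^[n] p - f^[n + 1] p)) *
              (|f^[n + 1] y - f^[n + 1] y'| * |f^[n] x - f^[n] x'|)) * |y - y'| := by gcongr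
        _ = Real.exp (C * (f^[n] p - f^[n + 1] p)) * |f^[n + 1] y - f^[n + 1] y'| *
              (|f^[n] x - f^[n] x'| * |y - y'|) := by ring
        _ ≤ Real.exp (C * (f^[n] p - f^[n + 1] p)) * |f^[n + 1] y - f^[n + 1] y'| *
              (Real.exp (C * (p - f^[n] p)) * (|f^[n] y - f^[n] y'| * |x - x'|)) := by gcongr
        _ = Real.exp (C * (f^[n] p - f^[n + 1] p)) * Real.exp (C * (p - f^[n] p)) *
              (|f^[n + 1] y - f^[n + 1] y'| * |x - x'|) * |f^[n] y - f^[n] y'| := by ring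
        _ = _ := by
          rw [← Real.exp_add]
          congr 3
          ring_nf
  refine (key n).trans ?_
  gcongr
  exact ha n

/-! ### Kopell's lemma -/

/-- The `C¹` maps commuting with the contraction `f` and fixing `p` are uniformly Lipschitz on
`[f p, p]`. -/
theorem exists_lipschitz_bound_of_commute {f : ℝ → ℝ} (hf : ContDiff ℝ 2 f)
    (hpos : ∀ x, 0 < deriv f x) {z p : ℝ} (hmono : StrictMono f) (hp : f p < p)
    (hz : ∀ n : ℕ, z ≤ f^[n] p) :
    ∃ K : ℝ, ∀ v : ℝ → ℝ, ContDiff ℝ 1 v → Monotone v → Function.Commute v f → v p = p →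
      ∀ x ∈ Icc (f p) p, ∀ y ∈ Icc (f p) p, |v x - v y| ≤ K * |x - y| := by
  obtain ⟨E, hE, hdist⟩ := exists_iterate_distortion_bound hf hpos hmono hp.le hz
  have hanti : Antitone fun n : ℕ => f^[n] p := by
    refine antitone_nat_of_succ_le fun n => ?_
    rw [Function.iterate_succ_apply]
    exact (hmono.iterate n).monotone hp.le
  obtain ⟨a, hlim⟩ : ∃ a, Filter.Tendsto (fun n : ℕ => f^[n] p) Filter.atTop (nhds a) :=
    ⟨_, tendsto_atTop_ciInf hanti ⟨z, by rintro _ ⟨n, rfl⟩; exact hz n⟩⟩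
  have hlim' : ∀ x ∈ Icc (f p) p,
      Filter.Tendsto (fun n : ℕ => f^[n] x) Filter.atTop (nhds a) := by
    intro x hx
    refine tendsto_of_tendsto_of_tendsto_of_le_of_le (hlim.comp (Filter.tendsto_add_atTop_nat 1))
      hlim (fun n => ?_) fun n => (hmono.iterate n).monotone hx.2
    simp only [Function.comp_apply, Function.iterate_succ_apply]
    exact (hmono.iterate n).monotone hx.1
  refine ⟨2 * E, fun v hv hvm hcomm hvp x hx y hy => ?_⟩
  rcases eq_or_ne x y with rfl | hne
  · simp
  have hvmem : ∀ s ∈ Icc (f p) p, v s ∈ Icc (f p) p := by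
    intro s hs
    have h1 := hvm hs.1
    have h2 := hvm hs.2
    rw [hcomm.eq, hvp] at h1
    rw [hvp] at h2
    exact ⟨h1, h2⟩
  have hstrict : HasStrictDerivAt v (deriv v a) a :=
    hv.contDiffAt.hasStrictDerivAt (by norm_num)
  have hcommn : ∀ (n : ℕ) s, v (f^[n] s) = f^[n] (v s) := fun n s => (hcomm.iterate_right n).eq s
  -- `v` fixes the whole orbit of `p`, so its difference quotient between consecutive orbit points
  -- is 1. Both points move towards `a`, hence the strict derivative.
  have hderiv : deriv v a = 1 := by
    have hfp : f p ∈ Icc (f p) p := ⟨le_rfl, hp.le⟩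
    have h := hstrict.hasStrictFDerivAt.isLittleO.comp_tendsto
      ((hlim' _ hfp).prodMk_nhds hlim)
    have h2 := h.bound (c := |1 - deriv v a| / 2)
    by_contra hd
    have hd' : 0 < |1 - deriv v a| := abs_pos.2 (sub_ne_zero.2 (Ne.symm hd))
    obtain ⟨n, hn⟩ := (h2 (by positivity)).exists
    simp only [Function.comp_apply, hcommn, hvp, hcomm.eq,
      ContinuousLinearMap.toSpanSingleton_apply, smul_eq_mul, Real.norm_eq_abs] at hn
    set t := f^[n] (f p) - f^[n] p with ht
    have ht0 : 0 < |t| := abs_pos.2 (sub_ne_zero.2 ((hmono.iterate n).injective.ne hp.ne))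
    have e : t - t * deriv v a = t * (1 - deriv v a) := by ring
    rw [e, abs_mul] at hn
    nlinarith [mul_pos ht0 hd']
  -- Near `a` the slopes of `v` approach 1; any factor above 1 would do. Here `n` depends on `v`,
  -- `x` and `y`, but `E` does not depend on `n`.
  have hev : ∃ n : ℕ, |v (f^[n] x) - v (f^[n] y)| ≤ 2 * |f^[n] x - f^[n] y| := by
    have h := hstrict.hasStrictFDerivAt.isLittleO.comp_tendsto
      ((hlim' _ hx).prodMk_nhds (hlim' _ hy))
    obtain ⟨n, hn⟩ := (h.bound (c := 1) one_pos).exists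
    simp only [Function.comp_apply, hderiv,
      ContinuousLinearMap.toSpanSingleton_apply, smul_eq_mul, Real.norm_eq_abs, mul_one, one_mul] at hn
    refine ⟨n, ?_⟩
    have := abs_sub_abs_le_abs_sub (v (f^[n] x) - v (f^[n] y)) (f^[n] x - f^[n] y)
    linarith
  obtain ⟨n, hn⟩ := hev
  rw [hcommn, hcommn] at hn
  have h0 : 0 < |f^[n] x - f^[n] y| :=
    abs_pos.2 (sub_ne_zero.2 ((hmono.iterate n).injective.ne hne))
  have h1 := hdist n x hx y hy _ (hvmem x hx) _ (hvmem y hy)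
  refine le_of_mul_le_mul_left ?_ h0
  calc |f^[n] x - f^[n] y| * |v x - v y|
      ≤ E * (|f^[n] (v x) - f^[n] (v y)| * |x - y|) := h1
    _ ≤ E * (2 * |f^[n] x - f^[n] y| * |x - y|) := by gcongr
    _ = _ := by ring

theorem contDiff_iterate {n : WithTop ℕ∞} {v : ℝ → ℝ} (hv : ContDiff ℝ n v) :
    ∀ m : ℕ, ContDiff ℝ n v^[m]
  | 0 => contDiff_id
  | m + 1 => (contDiff_iterate hv m).comp hv

/-- **Kopell's lemma** on a fundamental domain. -/
theorem eq_self_of_commute_of_fixed {f : ℝ → ℝ} (hf : ContDiff ℝ 2 f)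
    (hpos : ∀ x, 0 < deriv f x) {z p : ℝ} (hmono : StrictMono f) (hp : f p < p)
    (hz : ∀ n : ℕ, z ≤ f^[n] p) {w : Equiv.Perm ℝ} (hw : StrictMono w)
    (hwc : Continuous w) (hwc' : ContDiff ℝ 1 (w.symm : ℝ → ℝ)) (hcomm : Function.Commute w f)
    (hwp : w p = p) {x : ℝ} (hx : x ∈ Icc (f p) p) : w x = x := by
  obtain ⟨K, hK⟩ := exists_lipschitz_bound_of_commute hf hpos hmono hp hz
  have hmem : ∀ m : ℕ, w^[m] x ∈ Icc (f p) p := by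
    intro m
    have h1 := (hw.iterate m).monotone hx.1
    have h2 := (hw.iterate m).monotone hx.2
    rw [(hcomm.iterate_left m).eq, Function.iterate_fixed hwp] at h1
    rw [Function.iterate_fixed hwp] at h2
    exact ⟨h1, h2⟩
  obtain ⟨c, hc⟩ : ∃ c, Filter.Tendsto (fun m : ℕ => w^[m] x) Filter.atTop (nhds c) := by
    rcases le_total x (w x) with h | h
    · exact ⟨_, tendsto_atTop_ciSup (hw.monotone.monotone_iterate_of_le_map h)
        ⟨p, by rintro _ ⟨n, rfl⟩; exact (hmem n).2⟩⟩
    · exact ⟨_, tendsto_atTop_ciInf (hw.monotone.antitone_iterate_of_map_le h)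
        ⟨f p, by rintro _ ⟨n, rfl⟩; exact (hmem n).1⟩⟩
  have hcmem : c ∈ Icc (f p) p := isClosed_Icc.mem_of_tendsto hc (Filter.Eventually.of_forall hmem)
  have hcfix : w c = c := isFixedPt_of_tendsto_iterate hc hwc.continuousAt
  have hsymm : StrictMono w.symm := strictMono_inv hw
  have hscomm : Function.Commute w.symm f := by
    intro y
    rw [Equiv.symm_apply_eq, hcomm.eq, Equiv.apply_symm_apply]
  -- The Lipschitz bound for the `m`-th power of `w⁻¹`, with `K` independent of `m`.
  have hle : ∀ m : ℕ, |x - c| ≤ K * |w^[m] x - c| := by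
    intro m
    have hleft : Function.LeftInverse (w.symm)^[m] w^[m] :=
      Function.LeftInverse.iterate w.symm_apply_apply m
    have h := hK (w.symm)^[m] (contDiff_iterate hwc' m) (hsymm.iterate m).monotone
      (hscomm.iterate_left m)
      (Function.iterate_fixed (by rw [Equiv.symm_apply_eq, hwp]) m) _ (hmem m) c hcmem
    rwa [hleft x, Function.iterate_fixed (by rw [Equiv.symm_apply_eq, hcfix]) m] at h
  have hzero : Filter.Tendsto (fun m : ℕ => K * |w^[m] x - c|) Filter.atTop (nhds 0) := by
    simpa using ((hc.sub_const c).abs.const_mul K)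
  have hxc : x = c := by
    have := ge_of_tendsto' hzero hle
    exact sub_eq_zero.1 (abs_eq_zero.1 (le_antisymm this (abs_nonneg _)))
  rw [hxc, hcfix]

theorem deriv_pos_of_mem_diffLine {r : ℕ∞} (hr : r ≠ 0) {g : Equiv.Perm ℝ} (hg : g ∈ DiffLine r)
    (hm : StrictMono g) (x : ℝ) : 0 < deriv g x := by
  have hr1 : (r : WithTop ℕ∞) ≠ 0 := by exact_mod_cast hr
  refine lt_of_le_of_ne hm.monotone.deriv_nonneg fun h0 => ?_
  have hcomp := ((hg.2.differentiable hr1) (g x)).hasDerivAt.comp x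
    ((hg.1.differentiable hr1) x).hasDerivAt
  have hid : (g.symm : ℝ → ℝ) ∘ g = id := funext fun y => g.symm_apply_apply y
  rw [hid, ← h0, mul_zero] at hcomp
  exact zero_ne_one (hcomp.unique (hasDerivAt_id x))

theorem IsCompactlySupported.exists_lt_fixed {g : Equiv.Perm ℝ} (hg : IsCompactlySupported g)
    (p : ℝ) : ∃ z < p, g z = z := by
  obtain ⟨b, hb⟩ := hg.bddBelow
  refine ⟨min b p - 1, by linarith [min_le_right b p], ?_⟩
  by_contra h
  have := hb (subset_closure h)
  linarith [min_le_left b p]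

/-! ### Uniqueness of square roots -/

/-- Two square roots of the same diffeomorphism agree wherever the square moves points down. -/
theorem apply_eq_of_sq_eq_of_lt {r : ℕ∞} (hr : 2 ≤ r) {g k : Equiv.Perm ℝ} (hg : g ∈ DiffcLine r)
    (hk : k ∈ DiffcLine r) (hsq : ∀ x, k (k x) = g (g x)) {x : ℝ} (hx : g (g x) < x) :
    k x = g x := by
  have hr0 : r ≠ 0 := by rintro rfl; simp at hr
  have hr2 : (2 : WithTop ℕ∞) ≤ r := WithTop.coe_le_coe.2 hr
  have hr1 : (1 : WithTop ℕ∞) ≤ r := le_trans (by norm_num) hr2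
  obtain ⟨hgd, hgc, hgm, -⟩ := id hg
  obtain ⟨hkd, -, hkm, -⟩ := id hk
  have hgx : g x < x := by
    by_contra! h
    exact absurd (h.trans (hgm.monotone h)) (not_le.2 hx)
  have hggx : g (g x) < g x := hgm hgx
  -- If `k x ≤ g x`, applying `k` gives `g (g x) ≤ k (g x)`, and likewise with `≥`: `k - g` changes
  -- sign between `x` and `g x`.
  obtain ⟨p, hpmem, hp⟩ : ∃ p ∈ Icc (g x) x, k p = g p := by
    have hcont : ContinuousOn (fun y => k y - g y) (Icc (g x) x) :=
      (hkd.1.continuous.sub hgd.1.continuous).continuousOn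
    suffices h : (0 : ℝ) ∈ (fun y => k y - g y) '' Icc (g x) x by
      obtain ⟨p, hp, he⟩ := h
      exact ⟨p, hp, sub_eq_zero.1 he⟩
    rcases le_total (k x) (g x) with h | h
    · refine intermediate_value_Icc' hgx.le hcont ⟨sub_nonpos.2 h, sub_nonneg.2 ?_⟩
      rw [← hsq]
      exact hkm.monotone h
    · refine intermediate_value_Icc hgx.le hcont ⟨sub_nonpos.2 ?_, sub_nonneg.2 h⟩
      rw [← hsq]
      exact hkm.monotone h
  have hsq' : ∀ y, (g * g) y = (k * k) y := fun y => (hsq y).symm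
  have hggd : g * g ∈ DiffLine r := mul_mem hgd hgd
  have hggm : StrictMono (g * g : Equiv.Perm ℝ) := hgm.comp hgm
  have hpx : (g * g) p < p := (hggm.monotone hpmem.2).trans_lt (hggx.trans_le hpmem.1)
  obtain ⟨z, hzp, hz⟩ := hgc.exists_lt_fixed p
  have hwd : g⁻¹ * k ∈ DiffLine r := mul_mem (inv_mem hgd) hkd
  have hcomm : Function.Commute (g⁻¹ * k : Equiv.Perm ℝ) (g * g : Equiv.Perm ℝ) := by
    intro y
    have heq : k * k = g * g := Equiv.ext hsq
    have : g⁻¹ * k * (g * g) = g * g * (g⁻¹ * k) := by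
      calc g⁻¹ * k * (g * g) = g⁻¹ * (k * k) * k := by rw [← heq]; group
        _ = g * g * (g⁻¹ * k) := by rw [heq]; group
    exact DFunLike.congr_fun this y
  -- `x` itself may lie above `p`, but its image under `g²` lies in the fundamental domain.
  have hfix : (g⁻¹ * k : Equiv.Perm ℝ) ((g * g) x) = (g * g) x := by
    refine eq_self_of_commute_of_fixed (f := (g * g : Equiv.Perm ℝ)) (z := z) (p := p)
      (hggd.1.of_le hr2) (deriv_pos_of_mem_diffLine hr0 hggd hggm) hggm hpx (fun n => ?_)
      (show StrictMono (g⁻¹ * k : Equiv.Perm ℝ) from (strictMono_inv hgm).comp hkm)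
      hwd.1.continuous (hwd.2.of_le hr1) hcomm ?_ ?_
    · have hzz : (g * g) z = z := by rw [Equiv.Perm.mul_apply, hz, hz]
      rw [← Function.iterate_fixed hzz n]
      exact (hggm.iterate n).monotone hzp.le
    · rw [Equiv.Perm.mul_apply, hp]; exact g.symm_apply_apply p
    · exact ⟨hggm.monotone hpmem.2, hggx.le.trans hpmem.1⟩
  rw [hcomm.eq] at hfix
  have := (g * g).injective hfix
  rwa [Equiv.Perm.mul_apply, Equiv.Perm.inv_eq_iff_eq] at this

/-- Points moved down by the square are covered by Kopell's lemma, points moved up by passing to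
inverses, and a point fixed by the square is fixed by every increasing root. -/
theorem eq_of_sq_eq {r : ℕ∞} (hr : 2 ≤ r) {g k : DiffcLine r} (hsq : k * k = g * g) : k = g := by
  have hval : ∀ x, (k : Equiv.Perm ℝ) ((k : Equiv.Perm ℝ) x) =
      (g : Equiv.Perm ℝ) ((g : Equiv.Perm ℝ) x) := fun x =>
    DFunLike.congr_fun (congrArg Subtype.val hsq) x
  have hgm : StrictMono (g : Equiv.Perm ℝ) := g.2.2.2.1
  have hkm : StrictMono (k : Equiv.Perm ℝ) := k.2.2.2.1
  ext x
  rcases lt_trichotomy ((g : Equiv.Perm ℝ) ((g : Equiv.Perm ℝ) x)) x with h | h | h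
  · exact apply_eq_of_sq_eq_of_lt hr g.2 k.2 hval h
  · have hroot : ∀ e : Equiv.Perm ℝ, StrictMono e → e (e x) = x → e x = x := by
      intro e he hex
      rcases lt_trichotomy (e x) x with h | h | h
      · exact absurd hex ((he h).trans h).ne
      · exact h
      · exact absurd hex (h.trans (he h)).ne'
    rw [hroot _ hgm h, hroot _ hkm ((hval x).trans h)]
  · have hinv : k⁻¹ * k⁻¹ = g⁻¹ * g⁻¹ := by rw [← mul_inv_rev, hsq, mul_inv_rev]
    have hval' : ∀ y, (k : Equiv.Perm ℝ)⁻¹ ((k : Equiv.Perm ℝ)⁻¹ y) =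
        (g : Equiv.Perm ℝ)⁻¹ ((g : Equiv.Perm ℝ)⁻¹ y) := fun y =>
      DFunLike.congr_fun (congrArg Subtype.val hinv) y
    -- The inverse square moves `g (g x)` down to `x`.
    have hy := apply_eq_of_sq_eq_of_lt hr (inv_mem g.2) (inv_mem k.2) hval'
      (x := (g : Equiv.Perm ℝ) ((g : Equiv.Perm ℝ) x)) (by simpa using h)
    rw [← hval] at hy
    exact ((k : Equiv.Perm ℝ).symm_apply_apply _).symm.trans (hy.trans (by
      rw [hval]; exact (g : Equiv.Perm ℝ).symm_apply_apply _))

theorem lemma5p2 (r : ℕ∞) (hr : 2 ≤ r) (g : DiffcLine r) :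
    Subgroup.centralizer ({g} : Set (DiffcLine r)) =
      Subgroup.centralizer ({g ^ 2} : Set (DiffcLine r)) := by
  ext h
  rw [Subgroup.mem_centralizer_singleton_iff, Subgroup.mem_centralizer_singleton_iff]
  refine ⟨fun hg => (Commute.pow_right hg 2 : Commute h (g ^ 2)), fun hg => ?_⟩
  rw [pow_two] at hg
  -- The conjugate of `g` by `h` is another square root of `g²`.
  have hsq : h * g * h⁻¹ * (h * g * h⁻¹) = g * g := by
    calc h * g * h⁻¹ * (h * g * h⁻¹) = h * (g * g) * h⁻¹ := by group
      _ = g * g := by rw [hg]; group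
  exact mul_inv_eq_iff_eq_mul.1 (eq_of_sq_eq hr hsq)
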